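/- Rademacher complexity bound. Let $m\ge 1$, let $\mathcal D=((x_i,y_i))_{i=1}^m$ be i.i.d. random pairs in $\mathcal X\times\mathcal Y$, and let $\ell:\mathbb R\times\mathcal Y\to[-b,b]$ be a measurable loss that is 1-Lipschitz in its first argument. Let $\{\mathcal H_t\}_{t\in T}$ be a collection of classes of measurable functions $\mathcal X\to\mathbb R$, and let $W$ be a random variable with values in the measurable space $T$, possibly dependent on $\mathcal D$, whose mutual information with the data, $I(W;\mathcal D)=I$ (in nats), is finite. Assume the usual measurability of suprema: for all real $a,s_1,\dots,s_m$, the map $(t,((x_i,y_i))_{i\le m})\mapsto\sup_{h\in\mathcal H_t}\big(a\,\mathbb E[\ell(h(x),y)]+\sum_{i=1}^m s_i\,\ell(h(x_i),y_i)\big)$ is measurable, where $(x,y)$ has the distribution of a data point (this holds, for instance, if the $\mathcal H_t$ are countable and $T$ is countable and discrete). Put $$\mathrm{gen}_{\mathcal D}(h)=\Big|\mathbb E[\ell(h(x),y)]-\frac1m\sum_{i=1}^m\ell(h(x_i),y_i)\Big|,\qquad \mathrm{Rad}_{\mathcal D}(\mathcal H)=\frac1m\,\mathbb E_{\sigma\sim\mathrm{Unif}\{\pm1\}^m}\Big[\sup_{h\in\mathcal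 H}\sum_{i=1}^m\sigma_i h(x_i)\Big],$$ with suprema taken in $[-\infty,+\infty]$. Then there is an absolute constant $a_1>0$ with $a_1^2=72$ such that, for every $\delta\in(0,1)$, with probability at least $1-\delta$, $$\sup_{h\in\mathcal H_W}\mathrm{gen}_{\mathcal D}(h)\le 2\,\mathrm{Rad}_{\mathcal D}(\mathcal H_W)+\frac{6}{\sqrt m}\sqrt{\frac{a_1^2b^2}{\delta}\Big(I+\frac{\delta}{2}\log\frac4\delta\Big)}.$$ -/

import Mathlib

open MeasureTheory ProbabilityTheory

noncomputable section

/-- Mutual information `I(U; V)`: the Kullback-Leibler divergence (natural logarithm) of the joint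
law of `(U, V)` from the product of its marginal laws. -/
def mutualInfo {Ω α β : Type*} [MeasurableSpace Ω] [MeasurableSpace α] [MeasurableSpace β]
    (μ : Measure Ω) (U : Ω → α) (V : Ω → β) : ENNReal :=
  InformationTheory.klDiv (μ.map fun ω => (U ω, V ω)) ((μ.map U).prod (μ.map V))

/-- The risk `𝔼[ℓ(h(x), y)]` of `h` when `(x, y)` has law `ν`. -/
def risk {𝒳 𝒴 : Type*} [MeasurableSpace 𝒳] [MeasurableSpace 𝒴]
    (ν : Measure (𝒳 × 𝒴)) (ℓ : ℝ → 𝒴 → ℝ) (h : 𝒳 → ℝ) : ℝ :=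
  ∫ z, ℓ (h z.1) z.2 ∂ν

/-- The generalization error of `h` on the data set `S = ((x₁, y₁), …, (x_m, y_m))`: the distance
between the risk and the empirical risk. -/
def genError {𝒳 𝒴 : Type*} [MeasurableSpace 𝒳] [MeasurableSpace 𝒴]
    (ν : Measure (𝒳 × 𝒴)) (ℓ : ℝ → 𝒴 → ℝ) {m : ℕ} (S : Fin m → 𝒳 × 𝒴) (h : 𝒳 → ℝ) : ℝ :=
  |risk ν ℓ h - (1 / (m : ℝ)) * ∑ i, ℓ (h (S i).1) (S i).2|

/-- The supremum of the generalization error over the class `H`, as an extended real. -/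
def supGenError {𝒳 𝒴 : Type*} [MeasurableSpace 𝒳] [MeasurableSpace 𝒴]
    (ν : Measure (𝒳 × 𝒴)) (ℓ : ℝ → 𝒴 → ℝ) {m : ℕ} (S : Fin m → 𝒳 × 𝒴)
    (H : Set (𝒳 → ℝ)) : EReal :=
  ⨆ h ∈ H, (genError ν ℓ S h : EReal)

/-- The data-dependent Rademacher complexity
`(1/m) 𝔼_σ [sup_{h ∈ H} ∑ i, σ i * h (x i)]`, where `σ` is uniform on the `2 ^ m` sign vectors.
The supremum is taken in the extended reals: it is `+∞` for a class that is unbounded on the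
sample. -/
def rademacherComplexity {𝒳 : Type*} {m : ℕ} (x : Fin m → 𝒳) (H : Set (𝒳 → ℝ)) : EReal :=
  ((1 / (m : ℝ) : ℝ) : EReal) * (((1 / (2 : ℝ) ^ m : ℝ) : EReal) *
    ∑ σ : Fin m → ℤˣ, ⨆ h ∈ H, ((∑ i, ((σ i : ℤ) : ℝ) * h (x i) : ℝ) : EReal))

/-- Measurability convention for (possibly uncountable) classes: suprema over `h ∈ H t` of linear
combinations of the risk of `h` and of its losses at the `m` sample points are measurable functions
of the index `t` and the sample, jointly. -/
def HasMeasurableSuprema {T 𝒳 𝒴 : Type*} [MeasurableSpace T] [MeasurableSpace 𝒳]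
    [MeasurableSpace 𝒴] (ν : Measure (𝒳 × 𝒴)) (ℓ : ℝ → 𝒴 → ℝ) (m : ℕ)
    (H : T → Set (𝒳 → ℝ)) : Prop :=
  ∀ (a : ℝ) (s : Fin m → ℝ), Measurable fun p : T × (Fin m → 𝒳 × 𝒴) =>
    ⨆ h ∈ H p.1, ((a * risk ν ℓ h + ∑ i, s i * ℓ (h (p.2 i).1) (p.2 i).2 : ℝ) : EReal)

end

/-! For an index independent of the data, each class can be treated as fixed, and a uniform
deviation bound fails with exponentially small probability. Finite mutual information transfers this
to the true joint law: `mul_measure_le_klDiv_add` gives `c * P E ≤ KL + (exp c - 1) * Q E`, with `P`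
the joint law and `Q` the product of the marginals. If `Q E ≤ 2 * exp (-K)` with `K = 72 * I / δ +
36 * log (4 / δ)`, a suitable `c` yields `P E ≤ δ`.

For a fixed class, the controlled quantity is `deviation`, which subtracts the Rademacher average of
the losses rather than of the functions `h`. Losses are bounded, so one sample point moves it by at
most `6 * b`, and McDiarmid's inequality applies. Symmetrization bounds its mean by `2 * b * √m`.

Only afterwards, on each sample separately, does the contraction principle (the loss is 1-Lipschitz)
replace the loss average by the Rademacher complexity of the class, which may be infinite. -/

/-! ### Change of measure -/

/-- Fenchel–Young inequality: `exp c - 1` is the convex conjugate of `klFun`. For `x > 0` it is `u +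
1 ≤ exp u` at `u = c - log x`, multiplied by `x`. -/
theorem mul_le_klFun_add_exp_sub_one {c x : ℝ} (hx : 0 ≤ x) :
    c * x ≤ InformationTheory.klFun x + (Real.exp c - 1) := by
  rw [InformationTheory.klFun_apply]
  rcases hx.eq_or_lt with rfl | hx
  · simp [(Real.exp_pos c).le]
  · have h := mul_le_mul_of_nonneg_left (Real.add_one_le_exp (c - Real.log x)) hx.le
    rw [Real.exp_sub, Real.exp_log hx, mul_div_cancel₀ _ hx.ne'] at h
    linarith

/-- Change of measure: a quantitative form of absolute continuity under a bounded
Kullback-Leibler divergence. -/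
theorem mul_measure_le_klDiv_add {α : Type*} [MeasurableSpace α] (P Q : Measure α)
    [IsFiniteMeasure P] [IsFiniteMeasure Q] {c : ℝ} (hc : 0 ≤ c) (E : Set α) :
    ENNReal.ofReal c * P E ≤
      InformationTheory.klDiv P Q + ENNReal.ofReal (Real.exp c - 1) * Q E := by
  by_cases hPQ : P ≪ Q
  swap; · simp [InformationTheory.klDiv_of_not_ac hPQ]
  rw [InformationTheory.klDiv_eq_lintegral_klFun_of_ac hPQ,
    ← Measure.setLIntegral_rnDeriv hPQ E, ← lintegral_const_mul _ (Measure.measurable_rnDeriv P Q),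
    ← setLIntegral_const]
  calc ∫⁻ x in E, ENNReal.ofReal c * P.rnDeriv Q x ∂Q
      ≤ ∫⁻ x in E, (ENNReal.ofReal (InformationTheory.klFun (P.rnDeriv Q x).toReal) +
          ENNReal.ofReal (Real.exp c - 1)) ∂Q := by
        refine lintegral_mono_ae (ae_restrict_of_ae ?_)
        filter_upwards [Measure.rnDeriv_lt_top P Q] with x hx
        rw [← ENNReal.ofReal_add (InformationTheory.klFun_nonneg ENNReal.toReal_nonneg)
          (by linarith [Real.add_one_le_exp c])]
        nth_rw 1 [← ENNReal.ofReal_toReal hx.ne]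
        rw [← ENNReal.ofReal_mul hc]
        exact ENNReal.ofReal_le_ofReal (mul_le_klFun_add_exp_sub_one ENNReal.toReal_nonneg)
    _ ≤ _ := by
        rw [lintegral_add_right _ measurable_const]
        exact add_le_add_left (setLIntegral_le_lintegral _ _) _

/-! ### McDiarmid's inequality -/

theorem measurePreserving_finCons {Z : Type*} [MeasurableSpace Z] (ν : Measure Z)
    [IsProbabilityMeasure ν] (n : ℕ) :
    MeasurePreserving (fun p : Z × (Fin n → Z) => (Fin.cons p.1 p.2 : Fin (n + 1) → Z))
      (ν.prod (Measure.pi fun _ => ν)) (Measure.pi fun _ => ν) := by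
  have h := (measurePreserving_piFinSuccAbove (fun _ : Fin (n + 1) => ν) 0).symm
  convert h using 1
  ext p i
  simp [MeasurableEquiv.piFinSuccAbove]

/-- McDiarmid's inequality in moment generating function form: a function with bounded differences
of i.i.d. variables is sub-Gaussian. -/
theorem integral_exp_sub_integral_le_of_bounded_differences {Z : Type*} [MeasurableSpace Z]
    (ν : Measure Z) [IsProbabilityMeasure ν] {n : ℕ} (c : Fin n → ℝ) (C : ℝ)
    (f : (Fin n → Z) → ℝ) (hf : Measurable f) (hC : ∀ S, |f S| ≤ C)
    (hd : ∀ S i z, |f (Function.update S i z) - f S| ≤ c i) (t : ℝ) :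
    ∫ S, Real.exp (t * (f S - ∫ S', f S' ∂Measure.pi fun _ => ν)) ∂(Measure.pi fun _ => ν) ≤
      Real.exp ((∑ i, c i ^ 2) / 4 * t ^ 2 / 2) := by
  induction n with
  | zero => simp [Measure.pi_of_empty (fun _ : Fin 0 => ν) Fin.elim0]
  | succ n ih =>
    set π := (Measure.pi fun _ : Fin n => ν)
    have hmp := measurePreserving_finCons ν n
    have hcons : Measurable fun p : Z × (Fin n → Z) => f (Fin.cons p.1 p.2) :=
      hf.comp hmp.measurable
    have int {α : Type _} [MeasurableSpace α] (κ : Measure α) [IsFiniteMeasure κ] {g : α → ℝ}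
        (hg : Measurable g) (B : ℝ) (hB : ∀ a, |g a| ≤ B) : Integrable g κ :=
      Integrable.of_bound hg.aestronglyMeasurable B (.of_forall hB)
    -- Averaging out all coordinates but the first splits the centred `f` into the centred `g` and,
    -- for each fixed first coordinate, a centred function of the others, to which the induction
    -- hypothesis applies.
    set g : Z → ℝ := fun z => ∫ S, f (Fin.cons z S) ∂π with hg
    have hgm : Measurable g :=
      (hcons.stronglyMeasurable.integral_prod_right' (ν := π)).measurable
    have hgC : ∀ z, |g z| ≤ C := fun z => by
      simpa using norm_integral_le_of_norm_le_const (μ := π) (f := fun S => f (Fin.cons z S))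
        (.of_forall fun S => hC _)
    have hsec (z : Z) : Measurable fun S : Fin n → Z => f (Fin.cons z S) :=
      hcons.comp measurable_prodMk_left
    have hEf : ∫ S, f S ∂(Measure.pi fun _ => ν) = ∫ z, g z ∂ν := by
      rw [← hmp.map_eq, integral_map hmp.measurable.aemeasurable hf.aestronglyMeasurable,
        integral_prod _ (int _ hcons C fun _ => hC _)]
    have hexp : Measurable fun S : Fin (n + 1) → Z => Real.exp (t * (f S - ∫ z, g z ∂ν)) := by
      fun_prop
    have hEgC : |∫ z, g z ∂ν| ≤ C := by
      simpa using norm_integral_le_of_norm_le_const (μ := ν) (f := g) (.of_forall hgC)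
    have hbd (x y : ℝ) (hx : |x| ≤ C) (hy : |y| ≤ C) :
        |Real.exp (t * (x - y))| ≤ Real.exp (|t| * (2 * C)) := by
      rw [abs_of_pos (Real.exp_pos _), Real.exp_le_exp]
      refine (le_abs_self _).trans ?_
      rw [abs_mul]
      refine mul_le_mul_of_nonneg_left ((abs_sub _ _).trans (by linarith)) (abs_nonneg t)
    have hint : Integrable (fun p : Z × (Fin n → Z) =>
        Real.exp (t * (f (Fin.cons p.1 p.2) - ∫ z, g z ∂ν))) (ν.prod π) :=
      int _ (hexp.comp hmp.measurable) _ fun _ => hbd _ _ (hC _) hEgC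
    rw [hEf, ← hmp.map_eq, integral_map hmp.measurable.aemeasurable hexp.aestronglyMeasurable,
      integral_prod _ hint]
    have hosc (z z' : Z) : g z ≤ g z' + c 0 := by
      have h : ∫ S, f (Fin.cons z S) ∂π ≤ ∫ S, (f (Fin.cons z' S) + c 0) ∂π := by
        refine integral_mono (int _ (hsec z) C fun _ => hC _)
          ((int _ (hsec z') C fun _ => hC _).add (integrable_const _)) fun S => ?_
        have := (abs_le.1 (hd (Fin.cons z' S) 0 z)).2
        rw [Fin.update_cons_zero] at this
        show f (Fin.cons z S) ≤ f (Fin.cons z' S) + c 0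
        linarith
      rw [integral_add (int _ (hsec z') C fun _ => hC _) (integrable_const _)] at h
      simpa using h
    have : Nonempty Z := nonempty_of_isProbabilityMeasure ν
    have hbdd : BddBelow (Set.range g) :=
      ⟨-C, by rintro _ ⟨z, rfl⟩; exact (abs_le.1 (hgC z)).1⟩
    -- Hoeffding's lemma: by `hosc`, the range of `g` lies in an interval of length `c 0` starting
    -- at its infimum.
    have hoeff := (hasSubgaussianMGF_of_mem_Icc (μ := ν) (X := g) (a := ⨅ z, g z)
      (b := (⨅ z, g z) + c 0) hgm.aemeasurable (.of_forall fun z =>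
        ⟨ciInf_le hbdd z, by
          rw [← sub_le_iff_le_add]
          exact le_ciInf fun z' => by linarith [hosc z z']⟩)).mgf_le t
    calc ∫ z, ∫ S, Real.exp (t * (f (Fin.cons z S) - ∫ z, g z ∂ν)) ∂π ∂ν
        ≤ ∫ z, Real.exp (t * (g z - ∫ z, g z ∂ν)) *
            Real.exp ((∑ i : Fin n, c i.succ ^ 2) / 4 * t ^ 2 / 2) ∂ν := by
          refine integral_mono_of_nonneg (.of_forall fun z => integral_nonneg fun S =>
            (Real.exp_pos _).le) ((int _ (by fun_prop) _ fun z => hbd _ _ (hgC z) hEgC).mul_const _)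
            (.of_forall fun z => ?_)
          have h := ih (fun i => c i.succ) (fun S => f (Fin.cons z S)) (hsec z) (fun _ => hC _)
            fun S i z' => by rw [Fin.cons_update]; exact hd _ _ _
          refine le_trans (le_of_eq ?_) (mul_le_mul_of_nonneg_left h (Real.exp_pos _).le)
          simp only []
          rw [← integral_const_mul]
          congr 1 with S
          rw [← Real.exp_add]
          congr 1
          simp only [hg]
          ring
      _ ≤ Real.exp ((c 0 ^ 2) / 4 * t ^ 2 / 2) *
            Real.exp ((∑ i : Fin n, c i.succ ^ 2) / 4 * t ^ 2 / 2) := by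
          rw [integral_mul_const]
          refine mul_le_mul_of_nonneg_right (hoeff.trans (le_of_eq ?_)) (Real.exp_pos _).le
          congr 3
          simp [div_pow]
          norm_num
      _ = _ := by
          rw [← Real.exp_add, Fin.sum_univ_succ]
          congr 1
          ring

/-- **McDiarmid's inequality.** -/
theorem measureReal_integral_add_le_of_bounded_differences {Z : Type*} [MeasurableSpace Z]
    (ν : Measure Z) [IsProbabilityMeasure ν] {n : ℕ} (c : Fin n → ℝ) (C : ℝ)
    (f : (Fin n → Z) → ℝ) (hf : Measurable f) (hC : ∀ S, |f S| ≤ C)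
    (hd : ∀ S i z, |f (Function.update S i z) - f S| ≤ c i) {r : ℝ} (hr : 0 ≤ r) :
    (Measure.pi fun _ => ν).real {S | r ≤ f S - ∫ S', f S' ∂Measure.pi fun _ => ν} ≤
      Real.exp (-r ^ 2 / (2 * ((∑ i, c i ^ 2) / 4))) := by
  have h : HasSubgaussianMGF (fun S => f S - ∫ S', f S' ∂Measure.pi fun _ => ν)
      ⟨(∑ i, c i ^ 2) / 4, by positivity⟩ (Measure.pi fun _ => ν) := by
    refine ⟨fun t => ?_, integral_exp_sub_integral_le_of_bounded_differences ν c C f hf hC hd⟩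
    refine integrable_exp_mul_of_mem_Icc (a := -C - ∫ S', f S' ∂Measure.pi fun _ => ν)
      (b := C - ∫ S', f S' ∂Measure.pi fun _ => ν) (by fun_prop) (.of_forall fun S => ?_)
    have := abs_le.1 (hC S)
    constructor <;> linarith
  exact h.measure_ge_le hr

/-! ### Rademacher contraction -/

theorem EReal.sum_ne_bot {κ : Type*} {s : Finset κ} {f : κ → EReal} (hf : ∀ i ∈ s, f i ≠ ⊥) :
    ∑ i ∈ s, f i ≠ ⊥ := by
  classical
  induction s using Finset.induction_on with
  | empty => simp
  | insert k A hk ih =>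
    rw [Finset.sum_insert hk, Ne, EReal.add_eq_bot_iff, not_or]
    exact ⟨hf k (by simp), ih fun i hi => hf i (by simp [hi])⟩

section Contraction

variable {ι κ : Type*} [Nonempty ι]

/-- The effect of one random sign. For near-maximizers `h`, `h'` on the left, `v h - v h'` is at
most `|u h - u h'|`; as `g h + g h'` is symmetric, exchanging `h` and `h'` removes the absolute
value. Boundedness is carried along so that the step can be iterated. -/
theorem ciSup_add_ciSup_sub_le_of_contraction {g u v : ι → ℝ}
    (huv : ∀ h h', |v h - v h'| ≤ |u h - u h'|) (hp : BddAbove (Set.range fun h => g h + u h))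
    (hm : BddAbove (Set.range fun h => g h - u h)) :
    BddAbove (Set.range fun h => g h + v h) ∧
      (⨆ h, (g h + v h)) + ⨆ h, (g h - v h) ≤ (⨆ h, (g h + u h)) + ⨆ h, (g h - u h) := by
  have key (h h' : ι) :
      (g h + v h) + (g h' - v h') ≤ (⨆ h, (g h + u h)) + ⨆ h, (g h - u h) := by
    have h1 := (le_abs_self _).trans (huv h h')
    rcases abs_cases (u h - u h') with ⟨h2, -⟩ | ⟨h2, -⟩
    · linarith [le_ciSup hp h, le_ciSup hm h']
    · linarith [le_ciSup hp h', le_ciSup hm h]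
  refine ⟨⟨(⨆ h, (g h + u h)) + (⨆ h, (g h - u h)) -
      (g (Classical.arbitrary ι) - v (Classical.arbitrary ι)), ?_⟩, ?_⟩
  · rintro _ ⟨h, rfl⟩
    have := key h (Classical.arbitrary ι)
    show g h + v h ≤ _
    linarith
  · rw [← le_sub_iff_add_le]
    refine ciSup_le fun h => ?_
    rw [le_sub_comm]
    exact ciSup_le fun h' => by linarith [key h h']

variable [Fintype κ] [DecidableEq κ]

/-- Each sign vector is paired with its flip at `k`; the other coordinates then play the role of `g`
in the one-sign inequality. -/
theorem signedSum_update_bddAbove_and_sum_ciSup_le {u : κ → ι → ℝ} (k : κ) {v : ι → ℝ}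
    (huv : ∀ h h', |v h - v h'| ≤ |u k h - u k h'|)
    (hu : ∀ σ : κ → ℤˣ, BddAbove (Set.range fun h => ∑ i, ((σ i : ℤ) : ℝ) * u i h)) :
    (∀ σ : κ → ℤˣ, BddAbove
      (Set.range fun h => ∑ i, ((σ i : ℤ) : ℝ) * Function.update u k v i h)) ∧
      ∑ σ : κ → ℤˣ, ⨆ h, ∑ i, ((σ i : ℤ) : ℝ) * Function.update u k v i h ≤
        ∑ σ : κ → ℤˣ, ⨆ h, ∑ i, ((σ i : ℤ) : ℝ) * u i h := by
  set flip : (κ → ℤˣ) → (κ → ℤˣ) := fun σ => Function.update σ k (-σ k) with hflip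
  have hinv : Function.Involutive flip := fun σ => by simp [hflip]
  set rest : (κ → ℤˣ) → ι → ℝ := fun σ h => ∑ i ∈ Finset.univ.erase k, ((σ i : ℤ) : ℝ) * u i h
  have e1 (σ : κ → ℤˣ) (h : ι) :
      ∑ i, ((σ i : ℤ) : ℝ) * u i h = rest σ h + ((σ k : ℤ) : ℝ) * u k h :=
    (Finset.sum_erase_add _ _ (Finset.mem_univ k)).symm
  have e2 (σ : κ → ℤˣ) (h : ι) : ∑ i, ((σ i : ℤ) : ℝ) * Function.update u k v i h =
      rest σ h + ((σ k : ℤ) : ℝ) * v h := by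
    rw [← Finset.sum_erase_add _ _ (Finset.mem_univ k), Function.update_self]
    congr 1
    refine Finset.sum_congr rfl fun i hi => ?_
    rw [Function.update_of_ne (Finset.ne_of_mem_erase hi)]
  have e3 (σ : κ → ℤˣ) (h : ι) : rest (flip σ) h = rest σ h := by
    refine Finset.sum_congr rfl fun i hi => ?_
    simp only [hflip, Function.update_of_ne (Finset.ne_of_mem_erase hi)]
  have e4 (σ : κ → ℤˣ) : (((flip σ k : ℤˣ) : ℤ) : ℝ) = -((σ k : ℤ) : ℝ) := by simp [hflip]
  have hσ (σ : κ → ℤˣ) : |((σ k : ℤ) : ℝ)| = 1 := by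
    rcases Int.units_eq_one_or (σ k) with h | h <;> simp [h]
  have pair (σ : κ → ℤˣ) := ciSup_add_ciSup_sub_le_of_contraction (g := rest σ)
    (u := fun h => ((σ k : ℤ) : ℝ) * u k h) (v := fun h => ((σ k : ℤ) : ℝ) * v h)
    (fun h h' => by
      rw [← mul_sub, ← mul_sub, abs_mul, abs_mul, hσ, one_mul, one_mul]
      exact huv h h')
    (by simpa only [e1] using hu σ)
    (by simpa only [e1, e3, e4, neg_mul, ← sub_eq_add_neg] using hu (flip σ))
  refine ⟨fun σ => by simpa only [e2] using (pair σ).1, ?_⟩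
  have hsum (X : (κ → ℤˣ) → ℝ) : ∑ σ, X (flip σ) = ∑ σ, X σ :=
    Equiv.sum_comp (hinv.toPerm flip) X
  have := Finset.sum_le_sum fun σ (_ : σ ∈ Finset.univ) => (pair σ).2
  simp only [Finset.sum_add_distrib] at this
  have f1 := hsum fun σ => ⨆ h, ∑ i, ((σ i : ℤ) : ℝ) * Function.update u k v i h
  have f2 := hsum fun σ => ⨆ h, ∑ i, ((σ i : ℤ) : ℝ) * u i h
  simp only [e1, e2, e3, e4, neg_mul, ← sub_eq_add_neg] at f1 f2 ⊢
  linarith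

/-- The Rademacher contraction principle for real-valued suprema. -/
theorem sum_ciSup_signedSum_le_of_contraction {u v : κ → ι → ℝ}
    (huv : ∀ i h h', |v i h - v i h'| ≤ |u i h - u i h'|)
    (hu : ∀ σ : κ → ℤˣ, BddAbove (Set.range fun h => ∑ i, ((σ i : ℤ) : ℝ) * u i h)) :
    ∑ σ : κ → ℤˣ, ⨆ h, ∑ i, ((σ i : ℤ) : ℝ) * v i h ≤
      ∑ σ : κ → ℤˣ, ⨆ h, ∑ i, ((σ i : ℤ) : ℝ) * u i h := by
  have key (A : Finset κ) :
      (∀ σ : κ → ℤˣ, BddAbove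
        (Set.range fun h => ∑ i, ((σ i : ℤ) : ℝ) * A.piecewise v u i h)) ∧
      ∑ σ : κ → ℤˣ, ⨆ h, ∑ i, ((σ i : ℤ) : ℝ) * A.piecewise v u i h ≤
        ∑ σ : κ → ℤˣ, ⨆ h, ∑ i, ((σ i : ℤ) : ℝ) * u i h := by
    induction A using Finset.induction_on with
    | empty => simpa using hu
    | insert k A hk ih =>
      rw [Finset.piecewise_insert]
      have := signedSum_update_bddAbove_and_sum_ciSup_le (u := A.piecewise v u) k (v := v k)
        (by simpa [Finset.piecewise_eq_of_notMem _ _ _ hk] using huv k) ih.1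
      exact ⟨this.1, this.2.trans ih.2⟩
  simpa using (key Finset.univ).2

theorem EReal.iSup_coe_ne_bot (x : ι → ℝ) : ⨆ h, (x h : EReal) ≠ ⊥ := fun h =>
  EReal.coe_ne_bot _ (le_bot_iff.1 ((le_iSup (fun h => (x h : EReal))
    (Classical.arbitrary ι)).trans h.le))

theorem EReal.bddAbove_and_coe_ciSup_of_ne_top {x : ι → ℝ} (hx : ⨆ h, (x h : EReal) ≠ ⊤) :
    BddAbove (Set.range x) ∧ ((⨆ h, x h : ℝ) : EReal) ≤ ⨆ h, (x h : EReal) := by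
  lift (⨆ h, (x h : EReal)) to ℝ using ⟨hx, EReal.iSup_coe_ne_bot x⟩ with r hr
  have (h : ι) : x h ≤ r := by
    rw [← EReal.coe_le_coe_iff, hr]
    exact le_iSup (fun h => (x h : EReal)) h
  exact ⟨⟨r, by rintro _ ⟨h, rfl⟩; exact this h⟩, EReal.coe_le_coe_iff.2 (ciSup_le this)⟩

/-- The Rademacher contraction principle, with the dominating suprema in the extended reals. -/
theorem coe_sum_ciSup_signedSum_le_of_contraction {u v : κ → ι → ℝ}
    (huv : ∀ i h h', |v i h - v i h'| ≤ |u i h - u i h'|) :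
    ((∑ σ : κ → ℤˣ, ⨆ h, ∑ i, ((σ i : ℤ) : ℝ) * v i h : ℝ) : EReal) ≤
      ∑ σ : κ → ℤˣ, ⨆ h, ((∑ i, ((σ i : ℤ) : ℝ) * u i h : ℝ) : EReal) := by
  by_cases hu : ∀ σ : κ → ℤˣ, ⨆ h, ((∑ i, ((σ i : ℤ) : ℝ) * u i h : ℝ) : EReal) ≠ ⊤
  · refine (EReal.coe_le_coe_iff.2 (sum_ciSup_signedSum_le_of_contraction huv fun σ =>
      (EReal.bddAbove_and_coe_ciSup_of_ne_top (hu σ)).1)).trans ?_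
    have hcoe (s : Finset (κ → ℤˣ)) (f : (κ → ℤˣ) → ℝ) :
        ((∑ σ ∈ s, f σ : ℝ) : EReal) = ∑ σ ∈ s, (f σ : EReal) := by
      induction s using Finset.induction_on with
      | empty => simp
      | insert a s ha ih => rw [Finset.sum_insert ha, Finset.sum_insert ha, EReal.coe_add, ih]
    rw [hcoe]
    exact Finset.sum_le_sum fun σ _ => (EReal.bddAbove_and_coe_ciSup_of_ne_top (hu σ)).2
  -- One infinite supremum makes the whole right side `⊤`, since no other term is `⊥`.
  · push Not at hu
    obtain ⟨σ, hσ⟩ := hu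
    rw [← Finset.add_sum_erase _
        (fun σ : κ → ℤˣ => ⨆ h, ((∑ i, ((σ i : ℤ) : ℝ) * u i h : ℝ) : EReal)) (Finset.mem_univ σ), hσ,
      EReal.top_add_of_ne_bot (EReal.sum_ne_bot fun τ _ => EReal.iSup_coe_ne_bot _)]
    exact le_top

end Contraction

/-! ### Moments of Rademacher sums -/

theorem sum_sq_signedSum (m : ℕ) :
    ∑ σ : Fin m → ℤˣ, (∑ i, ((σ i : ℤ) : ℝ)) ^ 2 = m * 2 ^ m := by
  induction m with
  | zero => simp
  | succ n ih =>
    rw [← (Fin.consEquiv fun _ : Fin (n + 1) => ℤˣ).sum_comp, Fintype.sum_prod_type]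
    simp only [Fin.consEquiv, Equiv.coe_fn_mk, Fin.sum_univ_succ, Fin.cons_zero, Fin.cons_succ,
      UnitsInt.univ]
    rw [Finset.sum_insert (by decide), Finset.sum_singleton, ← Finset.sum_add_distrib]
    have (x : ℝ) : ((((1 : ℤˣ) : ℤ) : ℝ) + x) ^ 2 + ((((-1 : ℤˣ) : ℤ) : ℝ) + x) ^ 2 =
      2 + 2 * x ^ 2 := by push_cast; ring
    simp only [this]
    rw [Finset.sum_add_distrib, ← Finset.mul_sum, ih]
    simp [Fintype.card_units_int]
    ring

/-- Cauchy–Schwarz against the second moment. -/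
theorem sum_abs_signedSum_le (m : ℕ) :
    ∑ σ : Fin m → ℤˣ, |∑ i, ((σ i : ℤ) : ℝ)| ≤ 2 ^ m * √m := by
  refine abs_le_of_sq_le_sq' ?_ (by positivity) |>.2
  refine (sq_sum_le_card_mul_sum_sq).trans (le_of_eq ?_)
  simp only [sq_abs]
  rw [sum_sq_signedSum, mul_pow, Real.sq_sqrt (by positivity)]
  simp [Fintype.card_units_int]
  ring

/-! ### Suprema of bounded losses -/

section LossSup

variable {𝒳 𝒴 : Type*} [MeasurableSpace 𝒳] [MeasurableSpace 𝒴]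

/-- `a * risk + ∑ i, s i * ℓ (h (x i)) (y i)`. -/
noncomputable def lossComb (ν : Measure (𝒳 × 𝒴)) (ℓ : ℝ → 𝒴 → ℝ) {m : ℕ} (a : ℝ) (s : Fin m → ℝ)
    (S : Fin m → 𝒳 × 𝒴) (h : 𝒳 → ℝ) : ℝ :=
  a * risk ν ℓ h + ∑ i, s i * ℓ (h (S i).1) (S i).2

/-- The real-valued supremum of `lossComb` over a class. -/
noncomputable def lossSup (ν : Measure (𝒳 × 𝒴)) (ℓ : ℝ → 𝒴 → ℝ) (H : Set (𝒳 → ℝ)) {m : ℕ} (a : ℝ)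
    (s : Fin m → ℝ) (S : Fin m → 𝒳 × 𝒴) : ℝ :=
  ⨆ h : H, lossComb ν ℓ a s S h

/-- The empirical Rademacher average of the loss class, not divided by the sample size. -/
noncomputable def lossRademacher (ν : Measure (𝒳 × 𝒴)) (ℓ : ℝ → 𝒴 → ℝ) (H : Set (𝒳 → ℝ)) {m : ℕ}
    (S : Fin m → 𝒳 × 𝒴) : ℝ :=
  1 / 2 ^ m * ∑ σ : Fin m → ℤˣ, lossSup ν ℓ H 0 (fun i => ((σ i : ℤ) : ℝ)) S

/-- The one-sided uniform deviation, for the side `c`, minus twice the Rademacher average. -/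
noncomputable def deviation (ν : Measure (𝒳 × 𝒴)) (ℓ : ℝ → 𝒴 → ℝ) (H : Set (𝒳 → ℝ)) {m : ℕ}
    (c : ℤˣ) (S : Fin m → 𝒳 × 𝒴) : ℝ :=
  lossSup ν ℓ H (-((c : ℤ) : ℝ) * m) (fun _ => ((c : ℤ) : ℝ)) S - 2 * lossRademacher ν ℓ H S

variable {ν : Measure (𝒳 × 𝒴)} {b : ℝ} {ℓ : ℝ → 𝒴 → ℝ}
  {H : Set (𝒳 → ℝ)} {m : ℕ}

theorem abs_int_units (c : ℤˣ) : |((c : ℤ) : ℝ)| = 1 := by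
  rcases Int.units_eq_one_or c with h | h <;> simp [h]

theorem lossSup_le (hH : H.Nonempty) {a r : ℝ} {s : Fin m → ℝ} {S : Fin m → 𝒳 × 𝒴}
    (hr : ∀ h ∈ H, lossComb ν ℓ a s S h ≤ r) : lossSup ν ℓ H a s S ≤ r :=
  have := hH.to_subtype
  ciSup_le fun h => hr h h.2

theorem deviation_empty (c : ℤˣ) (S : Fin m → 𝒳 × 𝒴) :
    deviation ν ℓ (∅ : Set (𝒳 → ℝ)) c S = 0 := by
  simp [deviation, lossRademacher, lossSup]

/-- Contraction on a fixed sample, with `u` the values of `h` and `v` the losses. -/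
theorem coe_lossRademacher_le (hℓ : ∀ y, LipschitzWith 1 fun u => ℓ u y) (hH : H.Nonempty)
    (S : Fin m → 𝒳 × 𝒴) :
    ((1 / (m : ℝ) * lossRademacher ν ℓ H S : ℝ) : EReal) ≤
      rademacherComplexity (fun i => (S i).1) H := by
  have := hH.to_subtype
  have h := coe_sum_ciSup_signedSum_le_of_contraction (ι := H) (κ := Fin m)
    (u := fun i h => (h : 𝒳 → ℝ) (S i).1) (v := fun i h => ℓ ((h : 𝒳 → ℝ) (S i).1) (S i).2)
    fun i h h' => by
      simpa [Real.dist_eq] using (hℓ (S i).2).dist_le_mul (h.1 (S i).1) (h'.1 (S i).1)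
  simp only [rademacherComplexity, lossRademacher, lossSup, lossComb, zero_mul,
    zero_add, EReal.coe_mul]
  simp only [iSup_subtype']
  refine mul_le_mul_of_nonneg_left (mul_le_mul_of_nonneg_left h ?_) ?_ <;>
    exact EReal.coe_nonneg.2 (by positivity)

variable [IsProbabilityMeasure ν]

theorem abs_risk_le (hb : ∀ u y, |ℓ u y| ≤ b) (h : 𝒳 → ℝ) : |risk ν ℓ h| ≤ b := by
  simpa [risk] using norm_integral_le_of_norm_le_const (μ := ν) (f := fun z => ℓ (h z.1) z.2)
    (.of_forall fun z => hb _ _)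

theorem abs_lossComb_le (hb : ∀ u y, |ℓ u y| ≤ b) (a : ℝ) (s : Fin m → ℝ) (S : Fin m → 𝒳 × 𝒴)
    (h : 𝒳 → ℝ) : |lossComb ν ℓ a s S h| ≤ (|a| + ∑ i, |s i|) * b := by
  refine (abs_add_le _ _).trans ?_
  rw [add_mul, abs_mul, Finset.sum_mul]
  refine add_le_add (mul_le_mul_of_nonneg_left (abs_risk_le hb h) (abs_nonneg a)) ?_
  refine (Finset.abs_sum_le_sum_abs _ _).trans (Finset.sum_le_sum fun i _ => ?_)
  rw [abs_mul]
  exact mul_le_mul_of_nonneg_left (hb _ _) (abs_nonneg _)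

theorem lossComb_le_lossSup (hb : ∀ u y, |ℓ u y| ≤ b) (a : ℝ) (s : Fin m → ℝ)
    (S : Fin m → 𝒳 × 𝒴) {h : 𝒳 → ℝ} (hh : h ∈ H) :
    lossComb ν ℓ a s S h ≤ lossSup ν ℓ H a s S :=
  le_ciSup (f := fun h : H => lossComb ν ℓ a s S h) ⟨(|a| + ∑ i, |s i|) * b, by
    rintro _ ⟨h, rfl⟩
    exact (abs_le.1 (abs_lossComb_le hb a s S h)).2⟩ ⟨h, hh⟩

theorem abs_lossSup_le (hb : ∀ u y, |ℓ u y| ≤ b) (hH : H.Nonempty) (a : ℝ) (s : Fin m → ℝ)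
    (S : Fin m → 𝒳 × 𝒴) : |lossSup ν ℓ H a s S| ≤ (|a| + ∑ i, |s i|) * b := by
  obtain ⟨h, hh⟩ := id hH
  exact abs_le.2 ⟨(abs_le.1 (abs_lossComb_le hb a s S h)).1.trans (lossComb_le_lossSup hb a s S hh),
    lossSup_le hH fun h _ => (abs_le.1 (abs_lossComb_le hb a s S h)).2⟩

theorem abs_lossRademacher_le (hb : ∀ u y, |ℓ u y| ≤ b) (hH : H.Nonempty) (S : Fin m → 𝒳 × 𝒴) :
    |lossRademacher ν ℓ H S| ≤ m * b := by
  rw [lossRademacher, abs_mul, abs_of_pos (by positivity), one_div, inv_mul_le_iff₀ (by positivity)]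
  refine (Finset.abs_sum_le_sum_abs _ _).trans ((Finset.sum_le_sum fun σ _ =>
    abs_lossSup_le hb hH _ _ _).trans (le_of_eq ?_))
  simp [abs_int_units, Fintype.card_units_int]

theorem abs_deviation_le (hb : ∀ u y, |ℓ u y| ≤ b) (hH : H.Nonempty) (c : ℤˣ)
    (S : Fin m → 𝒳 × 𝒴) : |deviation ν ℓ H c S| ≤ 4 * m * b := by
  have h1 := abs_lossSup_le (ν := ν) hb hH (-((c : ℤ) : ℝ) * m) (fun _ => ((c : ℤ) : ℝ)) S
  have h2 := abs_lossRademacher_le (ν := ν) hb hH S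
  simp only [abs_mul, abs_neg, abs_int_units, Nat.abs_cast, Finset.sum_const, Finset.card_univ,
    Fintype.card_fin, nsmul_eq_mul] at h1
  rw [abs_le] at h1 h2 ⊢
  constructor <;> simp only [deviation] <;> linarith [h1.1, h1.2, h2.1, h2.2]

theorem abs_lossSup_update_sub_le (hb : ∀ u y, |ℓ u y| ≤ b) (hH : H.Nonempty) (a : ℝ)
    (s : Fin m → ℝ) (S : Fin m → 𝒳 × 𝒴) (i : Fin m) (z : 𝒳 × 𝒴) :
    |lossSup ν ℓ H a s (Function.update S i z) - lossSup ν ℓ H a s S| ≤ 2 * |s i| * b := by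
  have key (h : 𝒳 → ℝ) :
      |lossComb ν ℓ a s (Function.update S i z) h - lossComb ν ℓ a s S h| ≤ 2 * |s i| * b := by
    rw [lossComb, lossComb, add_sub_add_left_eq_sub, ← Finset.sum_sub_distrib,
      Finset.sum_eq_single i]
    · rw [Function.update_self, ← mul_sub, abs_mul, mul_comm 2, mul_assoc]
      refine mul_le_mul_of_nonneg_left ?_ (abs_nonneg _)
      refine (abs_sub _ _).trans ?_
      linarith [hb (h z.1) z.2, hb (h (S i).1) (S i).2]
    · intro j _ hj
      simp [Function.update_of_ne hj]
    · simp
  rw [abs_sub_le_iff, sub_le_iff_le_add, sub_le_iff_le_add]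
  constructor <;> refine lossSup_le hH fun h hh => ?_
  · linarith [(abs_le.1 (key h)).2, lossComb_le_lossSup (ν := ν) hb a s S hh]
  · linarith [(abs_le.1 (key h)).1,
      lossComb_le_lossSup (ν := ν) hb a s (Function.update S i z) hh]

/-- The constant is `2 * b` from the supremum plus twice `2 * b` from the Rademacher average. -/
theorem abs_deviation_update_sub_le (hb : ∀ u y, |ℓ u y| ≤ b) (hH : H.Nonempty) (c : ℤˣ)
    (S : Fin m → 𝒳 × 𝒴) (i : Fin m) (z : 𝒳 × 𝒴) :
    |deviation ν ℓ H c (Function.update S i z) - deviation ν ℓ H c S| ≤ 6 * b := by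
  have h1 := abs_lossSup_update_sub_le (ν := ν) hb hH (-((c : ℤ) : ℝ) * m)
    (fun _ => ((c : ℤ) : ℝ)) S i z
  have h2 : |lossRademacher ν ℓ H (Function.update S i z) - lossRademacher ν ℓ H S| ≤ 2 * b := by
    rw [lossRademacher, lossRademacher, ← mul_sub, ← Finset.sum_sub_distrib, abs_mul,
      abs_of_pos (by positivity), one_div, inv_mul_le_iff₀ (by positivity)]
    refine (Finset.abs_sum_le_sum_abs _ _).trans ((Finset.sum_le_sum fun σ _ =>
      abs_lossSup_update_sub_le hb hH _ _ _ _ _).trans (le_of_eq ?_))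
    simp [abs_int_units, Fintype.card_units_int]
  rw [abs_int_units] at h1
  rw [abs_le] at h1 h2 ⊢
  constructor <;> simp only [deviation] <;> linarith [h1.1, h1.2, h2.1, h2.2]

theorem lossSup_add_le (hb : ∀ u y, |ℓ u y| ≤ b) (hH : H.Nonempty) (a a' : ℝ) (s s' : Fin m → ℝ)
    (S : Fin m → 𝒳 × 𝒴) :
    lossSup ν ℓ H (a + a') (s + s') S ≤ lossSup ν ℓ H a s S + lossSup ν ℓ H a' s' S := by
  refine lossSup_le hH fun h hh => (le_of_eq ?_).trans (add_le_add
    (lossComb_le_lossSup hb a s S hh) (lossComb_le_lossSup hb a' s' S hh))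
  simp only [lossComb, Pi.add_apply, add_mul, Finset.sum_add_distrib]
  ring

theorem lossSup_le_lossSup_zero_add (hb : ∀ u y, |ℓ u y| ≤ b) (hH : H.Nonempty) (a : ℝ)
    (s : Fin m → ℝ) (S : Fin m → 𝒳 × 𝒴) :
    lossSup ν ℓ H a s S ≤ lossSup ν ℓ H 0 s S + |a| * b := by
  refine lossSup_le hH fun h hh => ?_
  have h1 := lossComb_le_lossSup (ν := ν) hb 0 s S hh
  have h2 : a * risk ν ℓ h ≤ |a| * b := by
    refine (le_abs_self _).trans ?_
    rw [abs_mul]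
    exact mul_le_mul_of_nonneg_left (abs_risk_le hb h) (abs_nonneg a)
  simp only [lossComb, zero_mul, zero_add] at h1 ⊢
  linarith

/-! ### Symmetrization -/

/-- Replacing the coordinates outside `A` of an i.i.d. sample by those of an independent copy. -/
theorem measurePreserving_piecewise {Z : Type*} [MeasurableSpace Z] (ν : Measure Z)
    [IsProbabilityMeasure ν] (A : Finset (Fin m)) :
    MeasurePreserving (fun p : (Fin m → Z) × (Fin m → Z) => A.piecewise p.1 p.2)
      ((Measure.pi fun _ => ν).prod (Measure.pi fun _ => ν)) (Measure.pi fun _ => ν) := by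
  have hm : Measurable fun p : (Fin m → Z) × (Fin m → Z) => A.piecewise p.1 p.2 := by
    refine measurable_pi_lambda _ fun i => ?_
    by_cases hi : i ∈ A <;> simp only [Finset.piecewise, hi, if_true, if_false] <;> fun_prop
  refine ⟨hm, (Measure.pi_eq fun s hs => ?_).symm⟩
  rw [Measure.map_apply hm (MeasurableSet.univ_pi hs)]
  have : (fun p : (Fin m → Z) × (Fin m → Z) => A.piecewise p.1 p.2) ⁻¹' Set.univ.pi s =
      (Set.univ.pi fun i => if i ∈ A then s i else Set.univ) ×ˢ
        (Set.univ.pi fun i => if i ∈ A then Set.univ else s i) := by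
    ext p
    simp only [Set.mem_preimage, Set.mem_univ_pi, Set.mem_prod, ← forall_and]
    refine forall_congr' fun i => ?_
    by_cases hi : i ∈ A <;> simp [hi]
  rw [this, Measure.prod_prod, Measure.pi_pi, Measure.pi_pi, ← Finset.prod_mul_distrib]
  refine Finset.prod_congr rfl fun i _ => ?_
  by_cases hi : i ∈ A <;> simp [hi]

theorem integrable_lossSup (hb : ∀ u y, |ℓ u y| ≤ b) (hH : H.Nonempty)
    (hsup : ∀ a (s : Fin m → ℝ), Measurable (lossSup ν ℓ H a s)) (a : ℝ) (s : Fin m → ℝ) :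
    Integrable (lossSup ν ℓ H a s) (Measure.pi fun _ => ν) :=
  Integrable.of_bound (hsup a s).aestronglyMeasurable _ (.of_forall (abs_lossSup_le hb hH a s))

/-- A supremum of averages is at most the average of suprema. Integrating out the points outside `A`
turns each of their losses into the risk, whence the coefficient `a + ∑ i ∈ Aᶜ, s i`. -/
theorem integral_lossSup_le_of_restrict (hℓ : Measurable (Function.uncurry ℓ))
    (hb : ∀ u y, |ℓ u y| ≤ b) (hH : H.Nonempty) (hHm : ∀ h ∈ H, Measurable h)
    (hsup : ∀ a (s : Fin m → ℝ), Measurable (lossSup ν ℓ H a s)) (a : ℝ) (s : Fin m → ℝ)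
    (A : Finset (Fin m)) :
    ∫ S, lossSup ν ℓ H (a + ∑ i ∈ Aᶜ, s i) (A.piecewise s 0) S ∂(Measure.pi fun _ => ν) ≤
      ∫ S, lossSup ν ℓ H a s S ∂(Measure.pi fun _ => ν) := by
  have hmp := measurePreserving_piecewise (m := m) ν A
  have hint : Integrable (fun p : (Fin m → 𝒳 × 𝒴) × (Fin m → 𝒳 × 𝒴) =>
      lossSup ν ℓ H a s (A.piecewise p.1 p.2))
      ((Measure.pi fun _ => ν).prod (Measure.pi fun _ => ν)) :=
    hmp.integrable_comp_of_integrable (integrable_lossSup hb hH hsup a s)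
  have hmix : ∫ S, lossSup ν ℓ H a s S ∂(Measure.pi fun _ => ν) =
      ∫ S, ∫ S', lossSup ν ℓ H a s (A.piecewise S S') ∂(Measure.pi fun _ => ν)
        ∂(Measure.pi fun _ => ν) := by
    conv_lhs => rw [← hmp.map_eq]
    rw [integral_map hmp.measurable.aemeasurable (hsup a s).aestronglyMeasurable,
      integral_prod _ hint]
  rw [hmix]
  refine integral_mono (integrable_lossSup hb hH hsup _ _) hint.integral_prod_left fun S =>
    lossSup_le hH fun h hh => ?_
  have hmeas : Measurable fun z : 𝒳 × 𝒴 => ℓ (h z.1) z.2 :=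
    hℓ.comp (((hHm h hh).comp measurable_fst).prodMk measurable_snd)
  have hcomp (i : Fin m) : Integrable (fun S' : Fin m → 𝒳 × 𝒴 => ℓ (h (S' i).1) (S' i).2)
      (Measure.pi fun _ => ν) :=
    Integrable.of_bound (hmeas.comp (measurable_pi_apply i)).aestronglyMeasurable b
      (.of_forall fun _ => hb _ _)
  have hrisk (i : Fin m) : ∫ S' : Fin m → 𝒳 × 𝒴, ℓ (h (S' i).1) (S' i).2
      ∂(Measure.pi fun _ => ν) = risk ν ℓ h := by
    have hp := measurePreserving_eval (fun _ : Fin m => ν) i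
    conv_rhs => rw [risk, ← hp.map_eq]
    rw [integral_map hp.measurable.aemeasurable hmeas.aestronglyMeasurable]
  have hsplit (S' : Fin m → 𝒳 × 𝒴) : lossComb ν ℓ a s (A.piecewise S S') h =
      (a * risk ν ℓ h + ∑ i ∈ A, s i * ℓ (h (S i).1) (S i).2) +
        ∑ i ∈ Aᶜ, s i * ℓ (h (S' i).1) (S' i).2 := by
    rw [lossComb, ← Finset.sum_add_sum_compl A, add_assoc]
    congr 2
    · exact Finset.sum_congr rfl fun i hi => by simp [hi]
    · exact Finset.sum_congr rfl fun i hi => by simp [Finset.mem_compl.1 hi]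
  have hI : Integrable (fun S' : Fin m → 𝒳 × 𝒴 => ∑ i ∈ Aᶜ, s i * ℓ (h (S' i).1) (S' i).2)
      (Measure.pi fun _ => ν) := integrable_finsetSum _ fun i _ => (hcomp i).const_mul _
  have hle : ∫ S', lossComb ν ℓ a s (A.piecewise S S') h ∂(Measure.pi fun _ => ν) ≤
      ∫ S', lossSup ν ℓ H a s (A.piecewise S S') ∂(Measure.pi fun _ => ν) := by
    refine integral_mono ?_ ?_ fun S' => lossComb_le_lossSup hb a s _ hh
    · simp only [hsplit]
      exact (integrable_const _).add hI
    · refine Integrable.of_bound (Measurable.aestronglyMeasurable ?_) _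
        (.of_forall fun S' => abs_lossSup_le hb hH a s _)
      exact (hsup a s).comp (hmp.measurable.comp measurable_prodMk_left)
  refine (le_of_eq ?_).trans hle
  simp only [hsplit]
  rw [integral_add (integrable_const _) hI, integral_finsetSum _ fun i _ => (hcomp i).const_mul _]
  simp only [integral_const_mul, hrisk, integral_const, probReal_univ, one_smul]
  rw [lossComb, ← Finset.sum_add_sum_compl A, ← Finset.sum_mul]
  have e1 : ∑ i ∈ A, A.piecewise s 0 i * ℓ (h (S i).1) (S i).2 =
      ∑ i ∈ A, s i * ℓ (h (S i).1) (S i).2 :=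
    Finset.sum_congr rfl fun i hi => by simp [hi]
  have e2 : ∑ i ∈ Aᶜ, A.piecewise s 0 i * ℓ (h (S i).1) (S i).2 = 0 :=
    Finset.sum_eq_zero fun i hi => by simp [Finset.mem_compl.1 hi]
  rw [e1, e2]
  ring

end LossSup

section LossSup

variable {𝒳 𝒴 : Type*} [MeasurableSpace 𝒳] [MeasurableSpace 𝒴]
  {ν : Measure (𝒳 × 𝒴)} [IsProbabilityMeasure ν] {b : ℝ} {ℓ : ℝ → 𝒴 → ℝ}
  {H : Set (𝒳 → ℝ)} {m : ℕ}

/-- Symmetrization with a fixed sign vector. -/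
theorem integral_lossSup_le_signed (hℓ : Measurable (Function.uncurry ℓ))
    (hb : ∀ u y, |ℓ u y| ≤ b) (hH : H.Nonempty) (hHm : ∀ h ∈ H, Measurable h)
    (hsup : ∀ a (s : Fin m → ℝ), Measurable (lossSup ν ℓ H a s)) (c : ℤˣ) (σ : Fin m → ℤˣ) :
    ∫ S, lossSup ν ℓ H (-((c : ℤ) : ℝ) * m) (fun _ : Fin m => ((c : ℤ) : ℝ)) S
        ∂(Measure.pi fun _ => ν) ≤
      ∫ S, lossSup ν ℓ H 0 (fun i => ((σ i : ℤ) : ℝ)) S ∂(Measure.pi fun _ => ν) +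
      ∫ S, lossSup ν ℓ H 0 (fun i => (((-σ) i : ℤ) : ℝ)) S ∂(Measure.pi fun _ => ν) +
      2 * b * |∑ i, ((σ i : ℤ) : ℝ)| := by
  set s : Fin m → ℝ := fun i => ((σ i : ℤ) : ℝ) with hs
  have hneg : (fun i => (((-σ) i : ℤ) : ℝ)) = -s := by ext i; simp [hs]
  rw [hneg]
  -- The constant sign `c` agrees with `σ` on `A` and with `-σ` on `Aᶜ`, so the uniform deviation
  -- splits into one piece for each.
  set A : Finset (Fin m) := Finset.univ.filter fun i => σ i = c with hA
  have hmem (i : Fin m) (hi : i ∈ A) : s i = ((c : ℤ) : ℝ) := by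
    simp only [hA, Finset.mem_filter, Finset.mem_univ, true_and] at hi
    simp [hs, hi]
  have hnot (i : Fin m) (hi : i ∉ A) : s i = -((c : ℤ) : ℝ) := by
    simp only [hA, Finset.mem_filter, Finset.mem_univ, true_and] at hi
    simp [hs, Int.units_ne_iff_eq_neg.1 hi]
  have int := integrable_lossSup hb hH hsup
  have hzero (a : ℝ) (s : Fin m → ℝ) :
      ∫ S, lossSup ν ℓ H a s S ∂(Measure.pi fun _ => ν) ≤
        ∫ S, lossSup ν ℓ H 0 s S ∂(Measure.pi fun _ => ν) + |a| * b := by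
    have := integral_mono (int a s) ((int 0 s).add (integrable_const (|a| * b))) fun S =>
      lossSup_le_lossSup_zero_add hb hH a s S
    refine this.trans (le_of_eq ?_)
    simp only [Pi.add_apply]
    rw [integral_add (int 0 s) (integrable_const _)]
    simp
  -- The risk coefficients `∓∑ i, s i` centre both pieces; dropping them through `hzero` costs `b *
  -- |∑ i, σ i|` each time.
  have h1 := (integral_lossSup_le_of_restrict hℓ hb hH hHm hsup (-∑ i, s i) s A).trans (hzero _ _)
  have h2 := (integral_lossSup_le_of_restrict hℓ hb hH hHm hsup (∑ i, s i) (-s) Aᶜ).trans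
    (hzero _ _)
  rw [abs_neg] at h1
  rw [compl_compl] at h2
  have ea : -((c : ℤ) : ℝ) * m =
      (-∑ i, s i + ∑ i ∈ Aᶜ, s i) + (∑ i, s i + ∑ i ∈ A, (-s) i) := by
    have e1 : ∑ i ∈ Aᶜ, s i + ∑ i ∈ A, (-s) i = ∑ _i : Fin m, -((c : ℤ) : ℝ) := by
      rw [add_comm, ← Finset.sum_add_sum_compl A]
      congr 1
      · exact Finset.sum_congr rfl fun i hi => by simp [hmem i hi]
      · exact Finset.sum_congr rfl fun i hi => hnot i (Finset.mem_compl.1 hi)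
    simp only [Finset.sum_const, Finset.card_univ, Fintype.card_fin, nsmul_eq_mul] at e1
    linarith
  have es : (fun _ : Fin m => ((c : ℤ) : ℝ)) = A.piecewise s 0 + Aᶜ.piecewise (-s) 0 := by
    ext i
    by_cases hi : i ∈ A
    · simp [hi, hmem i hi]
    · simp [hi, hnot i hi]
  have h3 := integral_mono (int _ _) ((int _ _).add (int _ _)) fun S =>
    lossSup_add_le hb hH (-∑ i, s i + ∑ i ∈ Aᶜ, s i) (∑ i, s i + ∑ i ∈ A, (-s) i)
      (A.piecewise s 0) (Aᶜ.piecewise (-s) 0) S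
  simp only [Pi.add_apply] at h3
  rw [integral_add (int _ _) (int _ _)] at h3
  rw [ea, es]
  linarith

/-- Average the fixed-sign bound over all `σ`. Since `σ ↦ -σ` permutes the sign vectors, both signed
terms average to the mean Rademacher average, leaving `2 * b` times the mean of `|∑ i, σ i|`. -/
theorem integral_deviation_le (hℓ : Measurable (Function.uncurry ℓ))
    (hb : ∀ u y, |ℓ u y| ≤ b) (hH : H.Nonempty) (hHm : ∀ h ∈ H, Measurable h)
    (hsup : ∀ a (s : Fin m → ℝ), Measurable (lossSup ν ℓ H a s)) (hb0 : 0 ≤ b) (c : ℤˣ) :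
    ∫ S : Fin m → 𝒳 × 𝒴, deviation ν ℓ H c S ∂(Measure.pi fun _ => ν) ≤ 2 * b * √m := by
  have int := integrable_lossSup hb hH hsup
  have hR : ∫ S : Fin m → 𝒳 × 𝒴, lossRademacher ν ℓ H S ∂(Measure.pi fun _ => ν) =
      1 / 2 ^ m * ∑ σ : Fin m → ℤˣ,
        ∫ S, lossSup ν ℓ H 0 (fun i => ((σ i : ℤ) : ℝ)) S ∂(Measure.pi fun _ => ν) := by
    simp only [lossRademacher]
    rw [integral_const_mul, integral_finsetSum _ fun σ _ => int _ _]
  have hRint : Integrable (fun S : Fin m → 𝒳 × 𝒴 => lossRademacher ν ℓ H S)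
      (Measure.pi fun _ => ν) :=
    (integrable_finsetSum _ fun σ _ => int _ _).const_mul _
  simp only [deviation]
  rw [integral_sub (int _ _) (hRint.const_mul 2), integral_const_mul, hR, sub_le_iff_le_add]
  have h := Finset.sum_le_sum fun σ (_ : σ ∈ (Finset.univ : Finset (Fin m → ℤˣ))) =>
    integral_lossSup_le_signed hℓ hb hH hHm hsup c σ
  rw [Finset.sum_add_distrib, Finset.sum_add_distrib, ← Finset.mul_sum, Finset.sum_const,
    nsmul_eq_mul] at h
  have hneg := Equiv.sum_comp (Equiv.neg (Fin m → ℤˣ)) fun σ =>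
    ∫ S, lossSup ν ℓ H 0 (fun i => ((σ i : ℤ) : ℝ)) S ∂(Measure.pi fun _ => ν)
  simp only [Equiv.neg_apply] at hneg
  rw [hneg] at h
  have hcard : ((Finset.univ : Finset (Fin m → ℤˣ)).card : ℝ) = 2 ^ m := by
    simp [Fintype.card_units_int]
  rw [hcard] at h
  have h2 := mul_le_mul_of_nonneg_left (sum_abs_signedSum_le m) (by positivity : 0 ≤ 2 * b)
  refine le_of_mul_le_mul_left ?_ (by positivity : (0 : ℝ) < 2 ^ m)
  refine (h.trans (add_le_add_right h2 _)).trans (le_of_eq ?_)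
  field_simp
  ring

/-! ### Concentration, and return to the generalization error -/

theorem measureReal_le_deviation_le (hℓ : Measurable (Function.uncurry ℓ))
    (hb : ∀ u y, |ℓ u y| ≤ b) (hH : H.Nonempty) (hHm : ∀ h ∈ H, Measurable h)
    (hsup : ∀ a (s : Fin m → ℝ), Measurable (lossSup ν ℓ H a s)) (hb0 : 0 ≤ b) (c : ℤˣ) {r : ℝ}
    (hr : 0 ≤ r) :
    (Measure.pi fun _ => ν).real {S : Fin m → 𝒳 × 𝒴 | 2 * b * √m + r ≤ deviation ν ℓ H c S} ≤
      Real.exp (-r ^ 2 / (18 * b ^ 2 * m)) := by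
  have hm : Measurable fun S : Fin m → 𝒳 × 𝒴 => deviation ν ℓ H c S :=
    (hsup _ _).sub (((Finset.measurable_sum _ fun σ _ => hsup _ _).const_mul _).const_mul _)
  have h := measureReal_integral_add_le_of_bounded_differences ν (fun _ : Fin m => 6 * b)
    (4 * m * b) _ hm (abs_deviation_le hb hH c) (abs_deviation_update_sub_le hb hH c) hr
  have e : 2 * ((∑ _i : Fin m, (6 * b) ^ 2) / 4) = 18 * b ^ 2 * m := by
    simp
    ring
  rw [e] at h
  refine (measureReal_mono fun S hS => ?_).trans h
  have := integral_deviation_le hℓ hb hH hHm hsup hb0 c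
  simp only [Set.mem_ofPred_eq] at hS ⊢
  linarith

/-- The sign `c = -1` controls risk minus empirical risk, and `c = 1` the reverse. -/
theorem supGenError_le_of_deviation_le (hℓ : ∀ y, LipschitzWith 1 fun u => ℓ u y)
    (hb : ∀ u y, |ℓ u y| ≤ b) (hH : H.Nonempty) (hm : 0 < m) {S : Fin m → 𝒳 × 𝒴} {x : ℝ}
    (hx : ∀ c, deviation ν ℓ H c S ≤ m * x) :
    supGenError ν ℓ S H ≤ 2 * rademacherComplexity (fun i => (S i).1) H + (x : EReal) := by
  have hm' : (0 : ℝ) < m := Nat.cast_pos.2 hm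
  refine iSup₂_le fun h hh => ?_
  have hgen : genError ν ℓ S h ≤ 2 * (1 / (m : ℝ) * lossRademacher ν ℓ H S) + x := by
    have hc (c : ℤˣ) : -((c : ℤ) : ℝ) *
        (risk ν ℓ h - 1 / (m : ℝ) * ∑ i, ℓ (h (S i).1) (S i).2) ≤
        2 * (1 / (m : ℝ) * lossRademacher ν ℓ H S) + x := by
      have h1 := lossComb_le_lossSup (ν := ν) hb (-((c : ℤ) : ℝ) * m) (fun _ => ((c : ℤ) : ℝ)) S hh
      have h2 := hx c
      simp only [deviation, lossComb, ← Finset.mul_sum] at h1 h2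
      refine le_of_mul_le_mul_left ?_ hm'
      have e1 : (m : ℝ) * (-((c : ℤ) : ℝ) *
          (risk ν ℓ h - 1 / (m : ℝ) * ∑ i, ℓ (h (S i).1) (S i).2)) =
          -((c : ℤ) : ℝ) * m * risk ν ℓ h + ((c : ℤ) : ℝ) * ∑ i, ℓ (h (S i).1) (S i).2 := by
        field_simp
        ring
      have e2 : (m : ℝ) * (2 * (1 / (m : ℝ) * lossRademacher ν ℓ H S) + x) =
          2 * lossRademacher ν ℓ H S + m * x := by
        field_simp
      linarith
    refine abs_le'.2 ⟨?_, ?_⟩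
    · simpa using hc (-1)
    · simpa using hc 1
  refine (EReal.coe_le_coe_iff.2 hgen).trans ?_
  rw [EReal.coe_add, EReal.coe_mul]
  exact add_le_add_left (mul_le_mul_of_nonneg_left (coe_lossRademacher_le hℓ hH S)
    (by norm_num)) _

end LossSup

/-! ### From the product law to the joint law -/

/-- An event of small product probability has small joint probability when the mutual information
is finite. -/
theorem measure_le_of_klDiv_eq {α : Type*} [MeasurableSpace α] {P Q : Measure α}
    [IsProbabilityMeasure P] [IsProbabilityMeasure Q] {I : NNReal}
    (hI : InformationTheory.klDiv P Q = I) {δ : ℝ} (h0 : 0 < δ) (h1 : δ < 1) {E : Set α}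
    (hE : Q.real E ≤ 2 * Real.exp (-(72 * I / δ + 36 * Real.log (4 / δ)))) :
    P E ≤ ENNReal.ofReal δ := by
  have hlog : 1 < Real.log (4 / δ) := by
    rw [Real.lt_log_iff_exp_lt (by positivity), lt_div_iff₀ h0]
    nlinarith [Real.exp_one_lt_d9, Real.exp_pos 1]
  -- This is the exponent in `hE` less one `log (4 / δ)`, so that `exp c * Q E ≤ 2 * (δ / 4)`.
  set c : ℝ := 72 * I / δ + 35 * Real.log (4 / δ) with hc
  have hI0 : (0 : ℝ) ≤ I := I.2
  have hc0 : 0 ≤ c := by positivity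
  have h := mul_measure_le_klDiv_add P Q hc0 E
  rw [hI] at h
  have hreal : c * P.real E ≤ I + (Real.exp c - 1) * Q.real E := by
    have hexp : 0 ≤ Real.exp c - 1 := by linarith [Real.add_one_le_exp c]
    have h' := ENNReal.toReal_mono (by finiteness) h
    rwa [ENNReal.toReal_add (by finiteness) (by finiteness), ENNReal.toReal_mul,
      ENNReal.toReal_mul, ENNReal.toReal_ofReal hc0, ENNReal.toReal_ofReal hexp] at h'
  have hQ : (Real.exp c - 1) * Q.real E ≤ δ / 2 := by
    calc (Real.exp c - 1) * Q.real E
        ≤ Real.exp c * (2 * Real.exp (-(72 * I / δ + 36 * Real.log (4 / δ)))) :=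
          mul_le_mul (by linarith) hE measureReal_nonneg (Real.exp_pos _).le
      _ = 2 * Real.exp (-Real.log (4 / δ)) := by
          rw [mul_left_comm, ← Real.exp_add]
          congr 2
          rw [hc]
          ring
      _ = δ / 2 := by
          rw [Real.exp_neg, Real.exp_log (by positivity), inv_div]
          ring
  have hcδ : I + δ / 2 ≤ c * δ := by
    have : c * δ = 72 * I + 35 * (δ * Real.log (4 / δ)) := by rw [hc]; field_simp
    nlinarith
  rw [← ofReal_measureReal]
  refine ENNReal.ofReal_le_ofReal (le_of_mul_le_mul_left ?_ (by positivity : 0 < c))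
  linarith

/-! ### Measurability and the two-sided tail for a fixed class -/

section LossSup

variable {T 𝒳 𝒴 : Type*} [MeasurableSpace T] [MeasurableSpace 𝒳] [MeasurableSpace 𝒴]
  {ν : Measure (𝒳 × 𝒴)} [IsProbabilityMeasure ν] {b : ℝ} {ℓ : ℝ → 𝒴 → ℝ} {m : ℕ}

/-- Transfers measurability from extended to real suprema. For the empty class both sides take the
default value `0`; otherwise bounded losses make the supremum finite. -/
theorem lossSup_eq_toReal (hb : ∀ u y, |ℓ u y| ≤ b) (H : Set (𝒳 → ℝ)) (a : ℝ) (s : Fin m → ℝ)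
    (S : Fin m → 𝒳 × 𝒴) :
    lossSup ν ℓ H a s S = (⨆ h ∈ H, (lossComb ν ℓ a s S h : EReal)).toReal := by
  rw [iSup_subtype']
  rcases H.eq_empty_or_nonempty with rfl | hH
  · simp [lossSup]
  · have := hH.to_subtype
    have h1 : ⨆ h : H, (lossComb ν ℓ a s S h : EReal) ≤ (lossSup ν ℓ H a s S : EReal) :=
      iSup_le fun h => EReal.coe_le_coe_iff.2 (lossComb_le_lossSup hb a s S h.2)
    have h2 := (EReal.bddAbove_and_coe_ciSup_of_ne_top
      (ne_top_of_le_ne_top (EReal.coe_ne_top _) h1)).2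
    rw [le_antisymm h1 h2, EReal.toReal_coe]

theorem HasMeasurableSuprema.measurable_lossSup {H : T → Set (𝒳 → ℝ)}
    (hH : HasMeasurableSuprema ν ℓ m H) (hb : ∀ u y, |ℓ u y| ≤ b) (a : ℝ) (s : Fin m → ℝ) :
    Measurable fun p : T × (Fin m → 𝒳 × 𝒴) => lossSup ν ℓ (H p.1) a s p.2 := by
  simp only [lossSup_eq_toReal hb]
  exact (hH a s).ereal_toReal

theorem HasMeasurableSuprema.measurable_deviation {H : T → Set (𝒳 → ℝ)}
    (hH : HasMeasurableSuprema ν ℓ m H) (hb : ∀ u y, |ℓ u y| ≤ b) (c : ℤˣ) :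
    Measurable fun p : T × (Fin m → 𝒳 × 𝒴) => deviation ν ℓ (H p.1) c p.2 :=
  (hH.measurable_lossSup hb _ _).sub (((Finset.measurable_sum _ fun _ _ =>
    hH.measurable_lossSup hb _ _).const_mul _).const_mul _)

/-- The level splits as `6 = 1 + 5`: since `√K ≥ 2`, one part absorbs the mean `2 * b * √m`, and `r
= 5 * b * √m * √K` gives exponent `25 / 18 * K ≥ K`. The factor `2` counts the signs. -/
theorem measure_exists_lt_deviation_le {H : Set (𝒳 → ℝ)} (hℓ : Measurable (Function.uncurry ℓ))
    (hb : ∀ u y, |ℓ u y| ≤ b) (hHm : ∀ h ∈ H, Measurable h)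
    (hsup : ∀ a (s : Fin m → ℝ), Measurable (lossSup ν ℓ H a s)) (hb0 : 0 ≤ b) (hm : 0 < m)
    {K : ℝ} (hK : 4 ≤ K) :
    (Measure.pi fun _ => ν)
        {S : Fin m → 𝒳 × 𝒴 | ∃ c, 6 * b * √m * √K < deviation ν ℓ H c S} ≤
      ENNReal.ofReal (2 * Real.exp (-K)) := by
  have hm' : (0 : ℝ) < m := Nat.cast_pos.2 hm
  rcases H.eq_empty_or_nonempty with rfl | hH
  · have : {S : Fin m → 𝒳 × 𝒴 | ∃ c, 6 * b * √m * √K < deviation ν ℓ ∅ c S} = ∅ := by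
      refine Set.eq_empty_of_forall_notMem fun S => ?_
      rintro ⟨c, hc⟩
      rw [deviation_empty] at hc
      exact absurd hc (by positivity : 0 ≤ 6 * b * √m * √K).not_gt
    simp [this]
  -- For `b = 0` the exponent in the tail bound divides by zero; here `deviation` simply vanishes.
  rcases hb0.eq_or_lt with rfl | hbpos
  · have : {S : Fin m → 𝒳 × 𝒴 | ∃ c, 6 * 0 * √m * √K < deviation ν ℓ H c S} = ∅ := by
      refine Set.eq_empty_of_forall_notMem fun S => ?_
      rintro ⟨c, hc⟩
      have := (abs_le.1 (abs_deviation_le (ν := ν) hb hH c S)).2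
      linarith
    rw [this, measure_empty]
    exact zero_le
  have hK2 : 2 ≤ √K := Real.le_sqrt_of_sq_le (by linarith)
  have key (c : ℤˣ) : (Measure.pi fun _ => ν)
      {S : Fin m → 𝒳 × 𝒴 | 6 * b * √m * √K < deviation ν ℓ H c S} ≤
      ENNReal.ofReal (Real.exp (-K)) := by
    rw [← ofReal_measureReal]
    refine ENNReal.ofReal_le_ofReal ((measureReal_mono fun S hS => ?_).trans
      ((measureReal_le_deviation_le hℓ hb hH hHm hsup hb0 c (r := 5 * b * √m * √K)
        (by positivity)).trans (Real.exp_le_exp.2 ?_)))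
    · simp only [Set.mem_ofPred_eq] at hS ⊢
      have : 0 ≤ b * √m := by positivity
      nlinarith
    · rw [mul_pow, mul_pow, mul_pow, Real.sq_sqrt hm'.le, Real.sq_sqrt (by linarith), neg_div,
        neg_le_neg_iff, le_div_iff₀ (by positivity)]
      have : 0 ≤ K * b ^ 2 * m := by positivity
      linarith
  calc (Measure.pi fun _ => ν) {S : Fin m → 𝒳 × 𝒴 | ∃ c, 6 * b * √m * √K < deviation ν ℓ H c S}
      = (Measure.pi fun _ => ν)
          (⋃ c, {S : Fin m → 𝒳 × 𝒴 | 6 * b * √m * √K < deviation ν ℓ H c S}) := by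
        congr 1
        ext S
        simp
    _ ≤ ∑ c : ℤˣ, (Measure.pi fun _ => ν)
          {S : Fin m → 𝒳 × 𝒴 | 6 * b * √m * √K < deviation ν ℓ H c S} :=
        measure_iUnion_fintype_le _ _
    _ ≤ ∑ _c : ℤˣ, ENNReal.ofReal (Real.exp (-K)) := Finset.sum_le_sum fun c _ => key c
    _ = ENNReal.ofReal (2 * Real.exp (-K)) := by
        rw [ENNReal.ofReal_mul (by norm_num)]
        simp

end LossSup

/-! ### The generalization bound -/

theorem theoremC2 :
    ∃ a₁ : ℝ, 0 < a₁ ∧ a₁ ^ 2 = 72 ∧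
      ∀ {Ω T 𝒳 𝒴 : Type*} [MeasurableSpace Ω] [MeasurableSpace T] [MeasurableSpace 𝒳]
        [MeasurableSpace 𝒴] (μ : Measure Ω) [IsProbabilityMeasure μ]
        (ν : Measure (𝒳 × 𝒴)) [IsProbabilityMeasure ν]
        (m : ℕ) (_ : 0 < m)
        -- the loss
        (b : ℝ) (ℓ : ℝ → 𝒴 → ℝ) (_ : Measurable (Function.uncurry ℓ))
        (_ : ∀ u y, ℓ u y ∈ Set.Icc (-b) b)
        (_ : ∀ y, LipschitzWith 1 fun u => ℓ u y)
        -- the function classes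
        (H : T → Set (𝒳 → ℝ)) (_ : ∀ t, ∀ h ∈ H t, Measurable h)
        (_ : HasMeasurableSuprema ν ℓ m H)
        -- the i.i.d. data and the random index
        (D : Fin m → Ω → 𝒳 × 𝒴) (_ : ∀ i, Measurable (D i)) (_ : iIndepFun D μ)
        (_ : ∀ i, μ.map (D i) = ν)
        (W : Ω → T) (_ : Measurable W)
        (I : NNReal) (_ : mutualInfo μ W (fun ω i => D i ω) = I)
        (δ : ℝ) (_ : 0 < δ) (_ : δ < 1),
        μ {ω | ¬ supGenError ν ℓ (fun i => D i ω) (H (W ω)) ≤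
            2 * rademacherComplexity (fun i => (D i ω).1) (H (W ω)) +
              ((6 / √(m : ℝ) *
                √(a₁ ^ 2 * b ^ 2 / δ * ((I : ℝ) + δ / 2 * Real.log (4 / δ))) : ℝ) : EReal)}
          ≤ ENNReal.ofReal δ := by
  refine ⟨√72, by positivity, Real.sq_sqrt (by norm_num), ?_⟩
  intro Ω T 𝒳 𝒴 _ _ _ _ μ _ ν _ m hm b ℓ hℓ hIcc hLip H hHm hsup D hD hind hlaw W hW I hI δ h0 h1
  rw [Real.sq_sqrt (by norm_num)]
  have hm' : (0 : ℝ) < m := Nat.cast_pos.2 hm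
  have hb : ∀ u y, |ℓ u y| ≤ b := fun u y => abs_le.2 (hIcc u y)
  have hb0 : 0 ≤ b := by
    obtain ⟨z⟩ := nonempty_of_isProbabilityMeasure ν
    exact (abs_nonneg _).trans (hb 0 z.2)
  have hI0 : (0 : ℝ) ≤ I := I.2
  have hlog : 1 < Real.log (4 / δ) := by
    rw [Real.lt_log_iff_exp_lt (by positivity), lt_div_iff₀ h0]
    nlinarith [Real.exp_one_lt_d9, Real.exp_pos 1]
  set K : ℝ := 72 * I / δ + 36 * Real.log (4 / δ) with hK
  have hK4 : 4 ≤ K := by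
    have : 0 ≤ 72 * (I : ℝ) / δ := by positivity
    linarith
  set x : ℝ := 6 / √(m : ℝ) * √(72 * b ^ 2 / δ * ((I : ℝ) + δ / 2 * Real.log (4 / δ))) with hx
  have hmx : (m : ℝ) * x = 6 * b * √m * √K := by
    have e1 : 72 * b ^ 2 / δ * ((I : ℝ) + δ / 2 * Real.log (4 / δ)) = b ^ 2 * K := by
      rw [hK]
      field_simp
      ring
    rw [hx, e1, Real.sqrt_mul (sq_nonneg b), Real.sqrt_sq hb0]
    nth_rw 1 [← Real.mul_self_sqrt hm'.le]
    field_simp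
  have hDm : Measurable fun ω i => D i ω := measurable_pi_lambda _ hD
  have hDlaw : μ.map (fun ω i => D i ω) = Measure.pi fun _ => ν := by
    rw [(iIndepFun_iff_map_fun_eq_pi_map fun i => (hD i).aemeasurable).1 hind]
    simp only [hlaw]
  have := Measure.isProbabilityMeasure_map (μ := μ) hW.aemeasurable
  have hpair : Measurable fun ω => (W ω, fun i => D i ω) := hW.prodMk hDm
  have := Measure.isProbabilityMeasure_map (μ := μ) hpair.aemeasurable
  rw [mutualInfo, hDlaw] at hI
  set E : Set (T × (Fin m → 𝒳 × 𝒴)) := {p | ∃ c, 6 * b * √m * √K < deviation ν ℓ (H p.1) c p.2}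
    with hEdef
  have hE : MeasurableSet E := by
    have : E = ⋃ c, {p | 6 * b * √m * √K < deviation ν ℓ (H p.1) c p.2} := by
      ext p
      simp [hEdef]
    rw [this]
    exact .iUnion fun c => measurableSet_lt measurable_const (hsup.measurable_deviation hb c)
  -- Under the product law, Fubini fixes the index `t`, so the tail bound for a single class
  -- applies.
  have hQ : ((μ.map W).prod (Measure.pi fun _ => ν)) E ≤ ENNReal.ofReal (2 * Real.exp (-K)) := by
    rw [Measure.prod_apply hE]
    refine (lintegral_mono fun t => measure_exists_lt_deviation_le hℓ hb (hHm t)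
      (fun a s => (hsup.measurable_lossSup hb a s).comp measurable_prodMk_left) hb0 hm hK4).trans ?_
    simp
  have hP := measure_le_of_klDiv_eq hI h0 h1
    (ENNReal.toReal_le_of_le_ofReal (by positivity) hQ)
  rw [Measure.map_apply hpair hE] at hP
  -- The failure event need not be measurable: it suffices that it lies in the preimage of `E`.
  refine (measure_mono fun ω hω => ?_).trans hP
  by_contra hnot
  refine hω ?_
  rcases (H (W ω)).eq_empty_or_nonempty with hemp | hne
  · simp [supGenError, hemp]
  · refine supGenError_le_of_deviation_le hLip hb hne hm fun c => ?_
    rw [hmx]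
    exact not_lt.1 fun hc => hnot ⟨c, hc⟩
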